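/- Let $d\ge 3$ and $M\ge 4$ be integers, and let $T_{M^d}$ be the $d$-dimensional toroidal grid with all sides equal to $M$, i.e. the simple graph with vertex set $(\mathbb{Z}/M\mathbb{Z})^d$ in which $x$ and $y$ are adjacent if and only if $x-y=\pm e_j$ for some $j\in\{1,\dots,d\}$, where $e_j$ is the vector with $1$ in position $j$ and $0$ elsewhere. Regard $T_{M^d}$ as an electrical network in which every edge has unit resistance. For vertices $u,v$ let $R_{\rm eff}(u,v)=W_u-W_v$, where $W$ is a potential (unique up to an additive constant) induced, via Ohm's and Kirchhoff's laws, by a unit current entering at $u$ and leaving at $v$, that is, $\sum_{x\sim w}(W_w-W_x)=\mathbf 1_{w=u}-\mathbf 1_{w=v}$ for every vertex $w$ (so $R_{\rm eff}(u,u)=0$). With $N=M^d$, let $$R_{\rm ave}(T_{M^d})=\frac{1}{2N^2}\sum_{u,v}R_{\rm eff}(u,v),$$ the sum being over all ordered pairs of vertices. Then $$R_{\rm ave}(T_{M^d})\le \frac{8}{d+1}\left(1+\frac1M\right)^{d+1}+\frac{d}{4M^{d-2}}\left(\frac13+\frac{(d-1)\log M}{\pi}\right)$$ and $$R_{\rm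 ave}(T_{M^d})\ge\frac{1}{4d},$$ where $\log$ is the natural logarithm. -/

import Mathlib

/-- `W` is an electrical potential on the network `G` (every edge a unit resistor) when a unit
current enters at `u` and leaves at `v`: by Ohm's law the current from `w` to a neighbour `x` is
`W w - W x`, and by Kirchhoff's law the net current leaving `w` is the external current at `w`. -/
def IsPotential {V : Type*} [Fintype V] (G : SimpleGraph V) (u v : V) (W : V → ℝ) : Prop :=
  open Classical in
  ∀ w : V, ∑ x with G.Adj w x, (W w - W x) = (if w = u then 1 else 0) - (if w = v then 1 else 0)

open Classical in
/-- Effective resistance between `u` and `v`: the potential difference `W u - W v`. On a connected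
graph the potential exists and is unique up to a constant, see `exists_isPotential` and
`effectiveResistance_eq`. -/
noncomputable def effectiveResistance {V : Type*} [Fintype V] (G : SimpleGraph V) (u v : V) : ℝ :=
  if h : ∃ W : V → ℝ, IsPotential G u v W then h.choose u - h.choose v else 0

/-- Average effective resistance `(1 / (2 N²)) ∑_{u,v} R_eff(u,v)`, with `N` the number of
vertices. -/
noncomputable def averageResistance {V : Type*} [Fintype V] (G : SimpleGraph V) : ℝ :=
  1 / (2 * (Fintype.card V : ℝ) ^ 2) * ∑ u : V, ∑ v : V, effectiveResistance G u v

/-- The toroidal `d`-grid with side lengths `M i`: the graph on `ℤ/M₁ × ⋯ × ℤ/M_d` in which distinct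
`x`, `y` are adjacent iff `x - y = ± e_j` for some `j`. -/
def toroidalGrid {d : ℕ} (M : Fin d → ℕ) : SimpleGraph ((i : Fin d) → ZMod (M i)) where
  Adj x y := x ≠ y ∧ ∃ j, x - y = Pi.single j 1 ∨ x - y = -Pi.single j 1
  symm := ⟨by
    rintro x y ⟨hne, j, h⟩
    refine ⟨hne.symm, j, ?_⟩
    rw [← neg_sub x y]
    rcases h with h | h
    · exact Or.inr (by rw [h])
    · exact Or.inl (by rw [h, neg_neg])⟩
  loopless := ⟨fun _ h => h.1 rfl⟩

/-- The toroidal `d`-grid with all sides equal to `M`. -/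
abbrev equalToroidalGrid (d M : ℕ) : SimpleGraph (Fin d → ZMod M) :=
  toroidalGrid (fun _ : Fin d => M)

open Classical in
theorem isPotential_iff {V : Type*} [Fintype V] (G : SimpleGraph V) (u v : V) (W : V → ℝ) :
    IsPotential G u v W ↔
      (G.lapMatrix ℝ).mulVec W = fun w => (if w = u then 1 else 0) - (if w = v then 1 else 0) := by
  rw [funext_iff]
  refine forall_congr' fun w => ?_
  rw [SimpleGraph.lapMatrix_mulVec_apply, Finset.sum_sub_distrib, Finset.sum_const, nsmul_eq_mul,
    ← SimpleGraph.card_neighborFinset_eq_degree, SimpleGraph.neighborFinset_eq_filter]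

theorem exists_isPotential {V : Type*} [Fintype V] {G : SimpleGraph V} (hG : G.Connected)
    (u v : V) : ∃ W : V → ℝ, IsPotential G u v W := by
  classical
  simp only [isPotential_iff]
  by_contra hcon
  have hb : (fun w => (if w = u then (1 : ℝ) else 0) - (if w = v then 1 else 0)) ∉
      LinearMap.range (Matrix.toLin' (G.lapMatrix ℝ)) := by
    rintro ⟨W, hW⟩
    rw [Matrix.toLin'_apply] at hW
    exact hcon ⟨W, by convert hW⟩
  obtain ⟨f, hf, hle⟩ := Submodule.exists_le_ker_of_notMem hb
  obtain ⟨c, rfl⟩ := (dotProductEquiv ℝ V).surjective f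
  have h0 : (G.lapMatrix ℝ).mulVec c = 0 := by
    apply dotProduct_eq_zero
    intro W
    have h1 : c ⬝ᵥ (G.lapMatrix ℝ).mulVec W = 0 := hle ⟨W, rfl⟩
    rw [Matrix.dotProduct_mulVec, ← Matrix.mulVec_transpose,
      (SimpleGraph.isSymm_lapMatrix ℝ G).eq] at h1
    exact h1
  have hc := (SimpleGraph.lapMatrix_mulVec_eq_zero_iff_forall_reachable G).1 h0 u v
    (hG.preconnected u v)
  apply hf
  simp [dotProductEquiv, dotProduct, mul_sub, Finset.sum_sub_distrib, hc]

theorem effectiveResistance_eq {V : Type*} [Fintype V] {G : SimpleGraph V} (hG : G.Connected)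
    {u v : V} {W : V → ℝ} (hW : IsPotential G u v W) :
    effectiveResistance G u v = W u - W v := by
  classical
  have h : ∃ W : V → ℝ, IsPotential G u v W := ⟨W, hW⟩
  have h0 : (G.lapMatrix ℝ).mulVec (h.choose - W) = 0 := by
    rw [Matrix.mulVec_sub]
    have h1 := (isPotential_iff G u v _).1 h.choose_spec
    have h2 := (isPotential_iff G u v W).1 hW
    rw [sub_eq_zero]
    convert h1.trans h2.symm
  have hc := (SimpleGraph.lapMatrix_mulVec_eq_zero_iff_forall_reachable G).1 h0 u v
    (hG.preconnected u v)
  simp only [Pi.sub_apply] at hc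
  rw [effectiveResistance, dif_pos h]
  linarith

/-! Characters diagonalise the Laplacian of the torus. The Green function G, with zero mode removed,
gives R_eff(u,v) = 2G(0) - 2G(u-v), and G has mean zero, so R_ave = G(0) = N⁻¹ ∑ λ_k⁻¹ over k ≠ 0
(`averageResistance_equalToroidalGrid`). Since 0⁻¹ = 0, the sums run over all k.

Lower bound: the mean of λ is 2d, and x⁻¹ is convex.

Upper bound: up to the factor 3/d, λ_k is the mean of the d three-dimensional eigenvalues read off
cyclic windows of coordinates, so Jensen (`inv_mean_le`) reduces the sum to d = 3. There λ is at
least its largest coordinate term, and a count gives O(M³) (`sum_inv_eigenvalue_three`). The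
resulting 81/(16d) + 1/(8M) lies below the first term of the stated bound. -/

namespace Torus

/-- Eigenvalue of the Laplacian of the cycle `ℤ/M` at the frequency `k`. -/
noncomputable def cycleEigenvalue {M : ℕ} [NeZero M] (k : ZMod M) : ℝ :=
  2 - 2 * (ZMod.stdAddChar k : ℂ).re

/-- Eigenvalue of the Laplacian of the torus `(ℤ/M)^ι` at the frequency `k`. -/
noncomputable def eigenvalue {ι : Type*} [Fintype ι] {M : ℕ} [NeZero M] (k : ι → ZMod M) : ℝ :=
  ∑ i, cycleEigenvalue (k i)

/-! ### Spectrum of the cycle -/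

section Cycle

variable {M : ℕ} [NeZero M]

theorem stdAddChar_re (k : ZMod M) :
    (ZMod.stdAddChar k : ℂ).re = Real.cos (2 * Real.pi * k.valMinAbs / M) := by
  have h := ZMod.stdAddChar_coe (N := M) k.valMinAbs
  rw [ZMod.coe_valMinAbs] at h
  rw [h, ← Complex.exp_ofReal_mul_I_re]
  congr 2
  push_cast
  ring

/-- For |t| ≤ π, 2 - 2 cos t ≥ 4t²/π²; here t = 2πk/M with k the representative of least absolute
value. -/
theorem cycleEigenvalue_lower (k : ZMod M) :
    16 * (k.valMinAbs.natAbs : ℝ) ^ 2 / (M : ℝ) ^ 2 ≤ cycleEigenvalue k := by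
  have hM : (0 : ℝ) < M := by exact_mod_cast Nat.pos_of_ne_zero (NeZero.ne M)
  have hmem := ZMod.valMinAbs_mem_Ioc k
  have h1 : -(M : ℝ) < k.valMinAbs * 2 := by exact_mod_cast hmem.1
  have h2 : (k.valMinAbs : ℝ) * 2 ≤ M := by exact_mod_cast hmem.2
  have hpi := Real.pi_pos
  have habs : |2 * Real.pi * k.valMinAbs / M| ≤ Real.pi := by
    rw [abs_le, le_div_iff₀ hM, div_le_iff₀ hM]
    constructor <;> nlinarith
  have hcos := Real.cos_le_one_sub_mul_cos_sq habs
  rw [cycleEigenvalue, stdAddChar_re]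
  have hsq : (k.valMinAbs.natAbs : ℝ) ^ 2 = (k.valMinAbs : ℝ) ^ 2 := by
    rw [Nat.cast_natAbs, Int.cast_abs, sq_abs]
  have he : 2 / Real.pi ^ 2 * (2 * Real.pi * k.valMinAbs / M) ^ 2
      = 8 * (k.valMinAbs : ℝ) ^ 2 / (M : ℝ) ^ 2 := by
    field_simp
    ring
  rw [he] at hcos
  have : 16 * (k.valMinAbs : ℝ) ^ 2 / (M : ℝ) ^ 2
      = 2 * (8 * (k.valMinAbs : ℝ) ^ 2 / (M : ℝ) ^ 2) := by ring
  rw [hsq, this]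
  linarith

theorem cycleEigenvalue_nonneg (k : ZMod M) : 0 ≤ cycleEigenvalue k :=
  le_trans (by positivity) (cycleEigenvalue_lower k)

theorem natAbs_valMinAbs_pos {n : ℕ} {k : ZMod n} (hk : k ≠ 0) : 0 < k.valMinAbs.natAbs :=
  Int.natAbs_pos.2 (by simpa using hk)

theorem le_cycleEigenvalue_of_ne_zero {k : ZMod M} (hk : k ≠ 0) :
    16 / (M : ℝ) ^ 2 ≤ cycleEigenvalue k := by
  refine le_trans ?_ (cycleEigenvalue_lower k)
  have : (1 : ℝ) ≤ k.valMinAbs.natAbs := by exact_mod_cast natAbs_valMinAbs_pos hk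
  gcongr
  nlinarith

theorem cycleEigenvalue_pos {k : ZMod M} (hk : k ≠ 0) : 0 < cycleEigenvalue k := by
  have hM : (0 : ℝ) < M := by exact_mod_cast Nat.pos_of_ne_zero (NeZero.ne M)
  exact lt_of_lt_of_le (by positivity) (le_cycleEigenvalue_of_ne_zero hk)

@[simp]
theorem cycleEigenvalue_zero : cycleEigenvalue (0 : ZMod M) = 0 := by
  simp [cycleEigenvalue]

theorem sum_cycleEigenvalue (hM : 2 ≤ M) : ∑ k : ZMod M, cycleEigenvalue k = 2 * M := by
  have : Fact (1 < M) := ⟨hM⟩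
  have h := AddChar.sum_mulShift (1 : ZMod M) (ZMod.isPrimitive_stdAddChar M)
  simp only [mul_one, one_ne_zero, if_false, Nat.cast_zero] at h
  have hre := congrArg Complex.re h
  simp only [Complex.re_sum, Complex.zero_re] at hre
  simp only [cycleEigenvalue, Finset.sum_sub_distrib, ← Finset.mul_sum, hre]
  simp [ZMod.card, mul_comm]

theorem card_valMinAbs_le (r : ℕ) :
    (Finset.univ.filter fun l : ZMod M => l.valMinAbs.natAbs ≤ r).card ≤ 2 * r + 1 := by
  have h := Finset.card_le_card_of_injOn
    (s := Finset.univ.filter fun l : ZMod M => l.valMinAbs.natAbs ≤ r)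
    (t := Finset.Icc (-(r : ℤ)) r) ZMod.valMinAbs
    (fun l hl => by
      simp only [Finset.coe_filter, Finset.mem_univ, true_and, Set.mem_ofPred_eq] at hl
      simp only [Finset.coe_Icc, Set.mem_Icc]
      omega)
    (fun _ _ _ _ h => ZMod.injective_valMinAbs h)
  rw [Int.card_Icc] at h
  omega

end Cycle

/-! ### Spectrum of the torus and the lower bound -/

section Eigenvalue

variable {ι : Type*} [Fintype ι] {M : ℕ} [NeZero M]

theorem eigenvalue_nonneg (k : ι → ZMod M) : 0 ≤ eigenvalue k :=
  Finset.sum_nonneg fun _ _ => cycleEigenvalue_nonneg _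

theorem cycleEigenvalue_le_eigenvalue (k : ι → ZMod M) (i : ι) :
    cycleEigenvalue (k i) ≤ eigenvalue k :=
  Finset.single_le_sum (f := fun i => cycleEigenvalue (k i))
    (fun _ _ => cycleEigenvalue_nonneg _) (Finset.mem_univ i)

@[simp]
theorem eigenvalue_zero : eigenvalue (0 : ι → ZMod M) = 0 := by
  simp [eigenvalue]

theorem le_eigenvalue_of_ne_zero {k : ι → ZMod M} (hk : k ≠ 0) :
    16 / (M : ℝ) ^ 2 ≤ eigenvalue k := by
  obtain ⟨i, hi⟩ := Function.ne_iff.1 hk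
  exact (le_cycleEigenvalue_of_ne_zero hi).trans (cycleEigenvalue_le_eigenvalue k i)

theorem eigenvalue_pos {k : ι → ZMod M} (hk : k ≠ 0) : 0 < eigenvalue k := by
  have hM : (0 : ℝ) < M := by exact_mod_cast Nat.pos_of_ne_zero (NeZero.ne M)
  exact lt_of_lt_of_le (by positivity) (le_eigenvalue_of_ne_zero hk)

/-- Summing a function of some of the coordinates over all points of a finite power. -/
theorem sum_comp_injective {κ α : Type*} [Fintype κ] [Fintype α] [DecidableEq ι] [DecidableEq κ]
    (g : κ → ι) (hg : Function.Injective g) (f : (κ → α) → ℝ) :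
    ∑ k : ι → α, f (k ∘ g)
      = (Fintype.card α : ℝ) ^ (Fintype.card ι - Fintype.card κ) * ∑ p, f p := by
  classical
  let e := Equiv.piEquivPiSubtypeProd (fun i => i ∈ Set.range g) (fun _ => α)
  let e' : ({i // i ∈ Set.range g} → α) ≃ (κ → α) :=
    (Equiv.arrowCongr (Equiv.ofInjective g hg).symm (Equiv.refl α))
  rw [Fintype.sum_equiv (e.trans (e'.prodCongr (Equiv.refl _))) (fun k => f (k ∘ g)) (fun q => f q.1)
    (fun k => rfl), Fintype.sum_prod_type]
  simp only [Finset.sum_const, nsmul_eq_mul, ← Finset.mul_sum]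
  congr 1
  rw [Finset.card_univ, Fintype.card_fun, Fintype.card_subtype_compl]
  push_cast
  congr 2
  exact (Fintype.card_congr (Equiv.ofInjective g hg)).symm

theorem sum_eigenvalue [DecidableEq ι] (hM : 2 ≤ M) :
    ∑ k : ι → ZMod M, eigenvalue k = 2 * Fintype.card ι * (M : ℝ) ^ Fintype.card ι := by
  simp only [eigenvalue]
  rw [Finset.sum_comm]
  have h : ∀ i : ι, ∑ k : ι → ZMod M, cycleEigenvalue (k i) = 2 * (M : ℝ) ^ Fintype.card ι := by
    intro i
    have h := sum_comp_injective (α := ZMod M) (fun _ : Unit => i)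
      (fun _ _ _ => rfl) (fun p => cycleEigenvalue (p ()))
    simp only [Function.comp_apply, ZMod.card, Fintype.card_unit] at h
    rw [h, Fintype.sum_equiv (Equiv.funUnique Unit (ZMod M)) (fun p => cycleEigenvalue (p ()))
      (fun k => cycleEigenvalue k)
      (fun _ => rfl), sum_cycleEigenvalue hM, mul_left_comm, ← pow_succ,
      Nat.sub_add_cancel (Fintype.card_pos_iff.2 ⟨i⟩)]
  simp only [h, Finset.sum_const, Finset.card_univ, nsmul_eq_mul]
  ring

/-- Lower bound for the average inverse eigenvalue, by the tangent line of `x⁻¹` at the mean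
eigenvalue. -/
theorem average_inv_eigenvalue_ge [DecidableEq ι] (hι : 2 ≤ Fintype.card ι) (hM : 2 ≤ M) :
    1 / (4 * (Fintype.card ι : ℝ)) ≤
      1 / (M : ℝ) ^ Fintype.card ι * ∑ k : ι → ZMod M, (eigenvalue k)⁻¹ := by
  set d : ℕ := Fintype.card ι with hd
  set N : ℝ := (M : ℝ) ^ d with hN
  have hd0 : (0 : ℝ) < d := by exact_mod_cast (by omega : 0 < d)
  -- Exactly what makes (N - 2)/(2d) ≥ N/(4d) at the end.
  have hN4 : (4 : ℝ) ≤ N := by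
    have h1 : 2 ^ 2 ≤ M ^ d :=
      (Nat.pow_le_pow_left hM 2).trans (Nat.pow_le_pow_right (by omega) hι)
    rw [hN]
    exact_mod_cast h1
  -- Tangent to x⁻¹ at x = 2d; the last term cancels its value 1/d at the zero mode, where the
  -- inverse is 0.
  have hpt : ∀ k : ι → ZMod M,
      1 / (d : ℝ) - eigenvalue k / (4 * (d : ℝ) ^ 2) - (if k = 0 then 1 / (d : ℝ) else 0)
        ≤ (eigenvalue k)⁻¹ := by
    intro k
    split_ifs with h
    · simp [h]
    · have hp := eigenvalue_pos h
      rw [sub_zero, ← sub_nonneg]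
      have : (eigenvalue k)⁻¹ - (1 / (d : ℝ) - eigenvalue k / (4 * (d : ℝ) ^ 2))
          = (eigenvalue k - 2 * d) ^ 2 / (4 * (d : ℝ) ^ 2 * eigenvalue k) := by
        field_simp
        ring
      rw [this]
      positivity
  have hs := Finset.sum_le_sum fun (k : ι → ZMod M) (_ : k ∈ Finset.univ) => hpt k
  simp only [Finset.sum_sub_distrib, ← Finset.sum_div, sum_eigenvalue hM, Finset.sum_ite_eq',
    Finset.mem_univ, if_true, Finset.sum_const, Finset.card_univ, Fintype.card_fun, ZMod.card,
    nsmul_eq_mul, Nat.cast_pow, ← hd, ← hN] at hs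
  have e : N * 1 / d - 2 * d * N / (4 * (d : ℝ) ^ 2) - 1 / d = (N - 2) / (2 * d) := by
    field_simp
    ring
  rw [e] at hs
  rw [one_div_mul_eq_div, le_div_iff₀ (by linarith)]
  refine le_trans ?_ hs
  rw [one_div_mul_eq_div, div_le_div_iff₀ (by positivity) (by positivity)]
  nlinarith

end Eigenvalue

/-! ### Upper bound for the inverse eigenvalues -/

variable {M : ℕ} [NeZero M]

/-- The sum of inverse eigenvalues over nonzero frequencies of the three-dimensional torus is
controlled by splitting according to a coordinate of largest absolute value. -/
theorem sum_inv_eigenvalue_three :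
    ∑ p : Fin 3 → ZMod M, (eigenvalue p)⁻¹ ≤ 27 / 16 * (M : ℝ) ^ 3 := by
  classical
  have hM : (0 : ℝ) < M := by exact_mod_cast Nat.pos_of_ne_zero (NeZero.ne M)
  -- Frequencies whose coordinate `j` equals `r` and is largest in absolute value, ties allowed.
  let box : Fin 3 → ZMod M → Finset (Fin 3 → ZMod M) := fun j r =>
    Fintype.piFinset fun i => if i = j then {r} else
      Finset.univ.filter fun l : ZMod M => l.valMinAbs.natAbs ≤ r.valMinAbs.natAbs
  have hbox : ∀ j r, ((box j r).card : ℝ) ≤ (2 * (r.valMinAbs.natAbs : ℝ) + 1) ^ 2 := by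
    intro j r
    have h := card_valMinAbs_le (M := M) r.valMinAbs.natAbs
    have h2 := Nat.mul_le_mul h h
    have : (box j r).card ≤ (2 * r.valMinAbs.natAbs + 1) ^ 2 := by
      simp only [box, Fintype.card_piFinset, Fin.prod_univ_three]
      rw [sq]
      fin_cases j <;> simpa using h2
    exact_mod_cast this
  have hpt : ∀ p : Fin 3 → ZMod M, (eigenvalue p)⁻¹ ≤
      ∑ j : Fin 3, ∑ r : ZMod M, if p ∈ box j r then (cycleEigenvalue r)⁻¹ else 0 := by
    intro p
    have hnn : ∀ (j : Fin 3) (r : ZMod M),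
        0 ≤ if p ∈ box j r then (cycleEigenvalue r)⁻¹ else 0 := by
      intro j r
      have := cycleEigenvalue_nonneg r
      split_ifs <;> positivity
    rcases eq_or_ne p 0 with rfl | hp
    · rw [eigenvalue_zero, inv_zero]
      exact Finset.sum_nonneg fun j _ => Finset.sum_nonneg fun r _ => hnn j r
    · obtain ⟨j, -, hj⟩ := Finset.exists_max_image Finset.univ
        (fun i : Fin 3 => (p i).valMinAbs.natAbs) Finset.univ_nonempty
      have hpj : p j ≠ 0 := by
        intro h0
        apply hp
        funext i
        have := hj i (Finset.mem_univ i)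
        rw [h0, ZMod.valMinAbs_zero, Int.natAbs_zero, Nat.le_zero, Int.natAbs_eq_zero,
          ZMod.valMinAbs_eq_zero] at this
        exact this
      have hmem : p ∈ box j (p j) := by
        simp only [box, Fintype.mem_piFinset]
        intro i
        split_ifs with h
        · simp [h]
        · simpa using hj i (Finset.mem_univ i)
      calc (eigenvalue p)⁻¹ ≤ (cycleEigenvalue (p j))⁻¹ :=
            inv_anti₀ (cycleEigenvalue_pos hpj) (cycleEigenvalue_le_eigenvalue p j)
        _ = if p ∈ box j (p j) then (cycleEigenvalue (p j))⁻¹ else 0 := by rw [if_pos hmem]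
        _ ≤ ∑ r : ZMod M, if p ∈ box j r then (cycleEigenvalue r)⁻¹ else 0 :=
            Finset.single_le_sum (f := fun r => if p ∈ box j r then (cycleEigenvalue r)⁻¹ else 0)
              (fun r _ => hnn j r) (Finset.mem_univ (p j))
        _ ≤ _ := Finset.single_le_sum
            (f := fun j => ∑ r : ZMod M, if p ∈ box j r then (cycleEigenvalue r)⁻¹ else 0)
            (fun j _ => Finset.sum_nonneg fun r _ => hnn j r) (Finset.mem_univ j)
  -- With m = |r| ≥ 1, the count (2m+1)² ≤ 9m² cancels against the eigenvalue bound 16m²/M².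
  have hterm : ∀ (j : Fin 3) (r : ZMod M),
      ((box j r).card : ℝ) * (cycleEigenvalue r)⁻¹ ≤ 9 / 16 * (M : ℝ) ^ 2 := by
    intro j r
    rcases eq_or_ne r 0 with rfl | hr
    · rw [cycleEigenvalue_zero, inv_zero, mul_zero]
      positivity
    · have h1 : (1 : ℝ) ≤ r.valMinAbs.natAbs := by exact_mod_cast natAbs_valMinAbs_pos hr
      have hl := cycleEigenvalue_lower r
      rw [div_le_iff₀ (by positivity)] at hl
      rw [← div_eq_mul_inv, div_le_iff₀ (cycleEigenvalue_pos hr)]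
      have := hbox j r
      nlinarith
  calc ∑ p : Fin 3 → ZMod M, (eigenvalue p)⁻¹
      ≤ ∑ p : Fin 3 → ZMod M, ∑ j : Fin 3, ∑ r : ZMod M,
          if p ∈ box j r then (cycleEigenvalue r)⁻¹ else 0 :=
        Finset.sum_le_sum fun p _ => hpt p
    _ = ∑ j : Fin 3, ∑ r : ZMod M, ((box j r).card : ℝ) * (cycleEigenvalue r)⁻¹ := by
        rw [Finset.sum_comm]
        refine Finset.sum_congr rfl fun j _ => ?_
        rw [Finset.sum_comm]
        refine Finset.sum_congr rfl fun r _ => ?_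
        rw [Finset.sum_ite_mem, Finset.univ_inter, Finset.sum_const, nsmul_eq_mul]
    _ ≤ ∑ _j : Fin 3, ∑ _r : ZMod M, 9 / 16 * (M : ℝ) ^ 2 :=
        Finset.sum_le_sum fun j _ => Finset.sum_le_sum fun r _ => hterm j r
    _ = 27 / 16 * (M : ℝ) ^ 3 := by
        simp [ZMod.card]
        ring

/-- Jensen's inequality for `x⁻¹`, with zero terms replaced by a value `2 / c` where `c` is a lower
bound for the mean. -/
theorem inv_mean_le {n : ℕ} (x : Fin n → ℝ) (hx : ∀ i, 0 ≤ x i) {c y : ℝ} (hc : 0 < c)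
    (hcy : c ≤ y) (hy : ∑ i, x i = n * y) :
    n / y ≤ ∑ i, if x i = 0 then 2 / c else (x i)⁻¹ := by
  have hy0 : 0 < y := hc.trans_le hcy
  -- Tangent to x⁻¹ at `y`; at 0 it equals 2/y ≤ 2/c, whence the replacement value.
  have hpt : ∀ i, 2 / y - x i / y ^ 2 ≤ if x i = 0 then 2 / c else (x i)⁻¹ := by
    intro i
    split_ifs with h
    · rw [h, zero_div, sub_zero]
      gcongr
    · have hp : 0 < x i := lt_of_le_of_ne (hx i) (Ne.symm h)
      rw [← sub_nonneg]
      have : (x i)⁻¹ - (2 / y - x i / y ^ 2) = (x i - y) ^ 2 / (y ^ 2 * x i) := by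
        field_simp
        ring
      rw [this]
      positivity
  refine le_trans (le_of_eq ?_) (Finset.sum_le_sum fun i _ => hpt i)
  rw [Finset.sum_sub_distrib, ← Finset.sum_div, ← Finset.sum_div, hy]
  simp only [Finset.sum_const, Finset.card_univ, Fintype.card_fin, nsmul_eq_mul]
  field_simp
  ring

/-- Upper bound for the average inverse eigenvalue, by averaging over cyclically consecutive
triples of coordinates. -/
theorem average_inv_eigenvalue_le {d : ℕ} (hd : 3 ≤ d) :
    1 / (M : ℝ) ^ d * ∑ k : Fin d → ZMod M, (eigenvalue k)⁻¹
      ≤ 81 / (16 * d) + 1 / (8 * M) := by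
  classical
  have hM : (0 : ℝ) < M := by exact_mod_cast Nat.pos_of_ne_zero (NeZero.ne M)
  have hd0 : (0 : ℝ) < d := by exact_mod_cast (by omega : 0 < d)
  have : NeZero d := ⟨by omega⟩
  -- The cyclic window i, i+1, i+2, without repetition because d ≥ 3.
  let g : Fin d → Fin 3 → Fin d := fun i s => i + Fin.castLE hd s
  have hg : ∀ i, Function.Injective (g i) := fun i s t h =>
    Fin.castLE_injective hd (add_left_cancel h)
  -- 3/d times the spectral gap bound 16/M².
  let c : ℝ := 48 / ((M : ℝ) ^ 2 * d)
  have hc : 0 < c := by positivity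
  let F : (Fin 3 → ZMod M) → ℝ := fun p => if eigenvalue p = 0 then 2 / c else (eigenvalue p)⁻¹
  have hFnn : ∀ p, 0 ≤ F p := by
    intro p
    have := eigenvalue_nonneg p
    simp only [F]
    split_ifs <;> positivity
  have hpt : ∀ k : Fin d → ZMod M,
      (eigenvalue k)⁻¹ ≤ 3 / (d : ℝ) ^ 2 * ∑ i, F (k ∘ g i) := by
    intro k
    rcases eq_or_ne k 0 with rfl | hk
    · rw [eigenvalue_zero, inv_zero]
      exact mul_nonneg (by positivity) (Finset.sum_nonneg fun i _ => hFnn _)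
    · have hp := eigenvalue_pos hk
      have hsum : ∑ i, eigenvalue (k ∘ g i) = d * (3 * eigenvalue k / d) := by
        have : ∀ s : Fin 3, ∑ i, cycleEigenvalue (k (g i s)) = eigenvalue k := fun s =>
          Fintype.sum_equiv (Equiv.addRight (Fin.castLE hd s)) _ _ (fun i => rfl)
        simp only [eigenvalue, Function.comp_apply] at this ⊢
        rw [Finset.sum_comm]
        simp only [this, Finset.sum_const, Finset.card_univ, Fintype.card_fin, nsmul_eq_mul]
        field_simp
        push_cast
        ring
      have hcy : c ≤ 3 * eigenvalue k / d := by
        have h := le_eigenvalue_of_ne_zero hk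
        have e : c = 3 * (16 / (M : ℝ) ^ 2) / d := by
          simp only [c]
          field_simp
          norm_num
        rw [e]
        gcongr
      have h := inv_mean_le (fun i => eigenvalue (k ∘ g i)) (fun i => eigenvalue_nonneg _) hc hcy
        hsum
      calc (eigenvalue k)⁻¹ = 3 / (d : ℝ) ^ 2 * (d / (3 * eigenvalue k / d)) := by
            field_simp
        _ ≤ _ := by gcongr
  have hF : ∑ p, F p ≤ (M : ℝ) ^ 2 * d / 24 + 27 / 16 * (M : ℝ) ^ 3 := by
    have h1 : ∀ p, F p ≤ (if p = 0 then 2 / c else 0) + (eigenvalue p)⁻¹ := by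
      intro p
      rcases eq_or_ne p 0 with rfl | hp
      · simp [F]
      · simp [F, hp, (eigenvalue_pos hp).ne']
    refine (Finset.sum_le_sum fun p _ => h1 p).trans ?_
    rw [Finset.sum_add_distrib, Finset.sum_ite_eq' Finset.univ 0, if_pos (Finset.mem_univ _)]
    refine add_le_add (le_of_eq ?_) sum_inv_eigenvalue_three
    simp only [c]
    field_simp
    norm_num
  have htot : ∑ k : Fin d → ZMod M, (eigenvalue k)⁻¹
      ≤ 3 / (d : ℝ) ^ 2 * (d * ((M : ℝ) ^ (d - 3) * ∑ p, F p)) := by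
    refine (Finset.sum_le_sum fun k _ => hpt k).trans (le_of_eq ?_)
    rw [← Finset.mul_sum, Finset.sum_comm]
    simp only [sum_comp_injective _ (hg _), ZMod.card, Fintype.card_fin, Finset.sum_const,
      Finset.card_univ, nsmul_eq_mul]
  have hpow : (M : ℝ) ^ d = (M : ℝ) ^ (d - 3) * (M : ℝ) ^ 3 := by
    rw [← pow_add, Nat.sub_add_cancel hd]
  calc 1 / (M : ℝ) ^ d * ∑ k : Fin d → ZMod M, (eigenvalue k)⁻¹
      ≤ 1 / (M : ℝ) ^ d * (3 / (d : ℝ) ^ 2 * (d * ((M : ℝ) ^ (d - 3) *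
          ((M : ℝ) ^ 2 * d / 24 + 27 / 16 * (M : ℝ) ^ 3)))) := by
        refine mul_le_mul_of_nonneg_left (htot.trans ?_) (by positivity)
        gcongr
    _ = 81 / (16 * d) + 1 / (8 * M) := by
        rw [hpow]
        field_simp
        ring

/-! ### The torus as a graph -/

variable {d : ℕ}

/-- Displacements that keep every point within its component form a subgroup containing the
generators e_j. -/
theorem connected_equalToroidalGrid (hM : 2 ≤ M) : (equalToroidalGrid d M).Connected := by
  have : Fact (1 < M) := ⟨hM⟩
  let H : AddSubgroup (Fin d → ZMod M) :=
    { carrier := {v | ∀ x, (equalToroidalGrid d M).Reachable x (x + v)}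
      zero_mem' := fun x => by rw [add_zero]
      add_mem' := fun {a b} ha hb x => (ha x).trans (by rw [← add_assoc]; exact hb (x + a))
      neg_mem' := fun {a} ha x => by
        have h := ha (x + -a)
        rw [neg_add_cancel_right] at h
        exact h.symm }
  have hsingle : ∀ j : Fin d, (Pi.single j 1 : Fin d → ZMod M) ∈ H := by
    intro j x
    refine SimpleGraph.Adj.reachable ⟨?_, j, Or.inr (by simp)⟩
    intro h
    have h1 : (Pi.single j 1 : Fin d → ZMod M) = 0 := left_eq_add.1 h
    simpa using congrFun h1 j
  have htop : ∀ v, v ∈ H := by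
    intro v
    rw [← Finset.univ_sum_single v]
    refine H.sum_mem fun j _ => ?_
    have : (Pi.single j (v j) : Fin d → ZMod M) = (v j).val • Pi.single j 1 := by
      rw [← Pi.single_smul, nsmul_one, ZMod.natCast_zmod_val]
    rw [this]
    exact H.nsmul_mem (hsingle j) _
  have : Nonempty (Fin d → ZMod M) := ⟨0⟩
  refine SimpleGraph.Connected.mk fun x y => ?_
  have h := htop (y - x) x
  rwa [add_sub_cancel] at h

open Classical in
theorem sum_adj_equalToroidalGrid (hM : 3 ≤ M) (w : Fin d → ZMod M)
    (f : (Fin d → ZMod M) → ℝ) :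
    ∑ x with (equalToroidalGrid d M).Adj w x, f x
      = ∑ j, (f (w + Pi.single j 1) + f (w - Pi.single j 1)) := by
  have : Fact (1 < M) := ⟨by omega⟩
  -- Needs M ≥ 3: otherwise w + e_j and w - e_j coincide and the neighbour sum would count them
  -- twice.
  have htwo : (1 : ZMod M) ≠ -1 := by
    intro h
    have h2 : ((2 : ℕ) : ZMod M) = 0 := by
      push_cast
      linear_combination h
    rw [ZMod.natCast_eq_zero_iff] at h2
    exact absurd (Nat.le_of_dvd (by norm_num) h2) (by omega)
  let φ : Fin d ⊕ Fin d → (Fin d → ZMod M) :=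
    Sum.elim (fun j => w + Pi.single j 1) (fun j => w - Pi.single j 1)
  have hpp : ∀ i j : Fin d, (Pi.single i 1 : Fin d → ZMod M) = Pi.single j 1 → i = j := by
    intro i j h
    by_contra hne
    have := congrFun h i
    rw [Pi.single_eq_same, Pi.single_eq_of_ne hne] at this
    exact one_ne_zero this
  have hpm : ∀ i j : Fin d, (Pi.single i 1 : Fin d → ZMod M) ≠ -Pi.single j 1 := by
    intro i j h
    have := congrFun h i
    rw [Pi.neg_apply, Pi.single_eq_same] at this
    by_cases hij : i = j
    · subst hij
      rw [Pi.single_eq_same] at this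
      exact htwo this
    · rw [Pi.single_eq_of_ne hij, neg_zero] at this
      exact one_ne_zero this
  have hφ : Function.Injective φ := by
    rintro (i | i) (j | j) h
    · exact congrArg _ (hpp i j (add_left_cancel h))
    · exact absurd (add_left_cancel (h.trans (sub_eq_add_neg _ _))) (hpm i j)
    · exact absurd (add_left_cancel (h.symm.trans (sub_eq_add_neg _ _))) (hpm j i)
    · exact congrArg _ (hpp i j (sub_right_injective h))
  have himg : (Finset.univ.filter fun x => (equalToroidalGrid d M).Adj w x)
      = Finset.univ.image φ := by
    ext x
    simp only [Finset.mem_filter, Finset.mem_univ, true_and, Finset.mem_image, Sum.exists]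
    constructor
    · rintro ⟨-, j, h | h⟩
      · exact Or.inr ⟨j, by simp only [φ, Sum.elim_inr, ← h, sub_sub_cancel]⟩
      · exact Or.inl ⟨j, by
          simp only [φ, Sum.elim_inl]
          rw [← neg_neg (Pi.single j 1), ← h, neg_sub, add_sub_cancel]⟩
    · have hne : ∀ j : Fin d, (Pi.single j 1 : Fin d → ZMod M) ≠ 0 := by
        intro j h
        simpa using congrFun h j
      rintro (⟨j, rfl⟩ | ⟨j, rfl⟩)
      · refine ⟨?_, j, Or.inr (by simp [φ])⟩
        exact fun h => hne j (left_eq_add.1 h)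
      · refine ⟨?_, j, Or.inl (by simp [φ])⟩
        exact fun h => hne j (sub_eq_self.1 h.symm)
  rw [himg, Finset.sum_image hφ.injOn, Fintype.sum_sum_type, Finset.sum_add_distrib]
  rfl

/-! ### Characters, Green function and resistance -/

/-- The character of `(ℤ/M)^d` with frequency `k`. -/
noncomputable def character (k x : Fin d → ZMod M) : ℂ := ∏ i, ZMod.stdAddChar (x i * k i)

theorem character_add (k x y : Fin d → ZMod M) :
    character k (x + y) = character k x * character k y := by
  simp only [character, ← Finset.prod_mul_distrib, Pi.add_apply, add_mul, AddChar.map_add_eq_mul]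

@[simp]
theorem character_zero (k : Fin d → ZMod M) : character k 0 = 1 := by
  simp [character]

theorem character_single (k : Fin d → ZMod M) (j : Fin d) (a : ZMod M) :
    character k (Pi.single j a) = ZMod.stdAddChar (a * k j) := by
  rw [character, Finset.prod_eq_single j]
  · simp
  · intro i _ hi
    simp [Pi.single_eq_of_ne hi]
  · simp

theorem character_comm (k x : Fin d → ZMod M) : character k x = character x k := by
  simp only [character, mul_comm]

theorem sum_character (x : Fin d → ZMod M) :
    ∑ k, character k x = if x = 0 then (M : ℂ) ^ d else 0 := by
  classical
  have h := Finset.prod_univ_sum (fun _ : Fin d => (Finset.univ : Finset (ZMod M)))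
    (fun i k => (ZMod.stdAddChar (k * x i) : ℂ))
  rw [Fintype.piFinset_univ] at h
  simp only [character, mul_comm (x _)]
  rw [← h]
  simp only [AddChar.sum_mulShift _ (ZMod.isPrimitive_stdAddChar M), ZMod.card]
  split_ifs with hx
  · simp [hx]
  · obtain ⟨i, hi⟩ := Function.ne_iff.1 hx
    exact Finset.prod_eq_zero (Finset.mem_univ i) (if_neg hi ▸ Nat.cast_zero)

theorem laplacian_character (k x : Fin d → ZMod M) :
    ∑ j, ((character k x - character k (x + Pi.single j 1))
      + (character k x - character k (x - Pi.single j 1))) = eigenvalue k * character k x := by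
  rw [eigenvalue, Complex.ofReal_sum, Finset.sum_mul]
  refine Finset.sum_congr rfl fun j _ => ?_
  rw [sub_eq_add_neg x, ← Pi.single_neg, character_add, character_add, character_single,
    character_single, one_mul, neg_one_mul, AddChar.map_neg_eq_conj, cycleEigenvalue]
  have h := Complex.add_conj (ZMod.stdAddChar (k j) : ℂ)
  push_cast at h ⊢
  linear_combination (-character k x) * h

/-- The Green function of the torus. -/
noncomputable def green (x : Fin d → ZMod M) : ℝ :=
  1 / (M : ℝ) ^ d * ∑ k, (eigenvalue k)⁻¹ * (character k x).re

theorem green_zero : green (0 : Fin d → ZMod M)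
    = 1 / (M : ℝ) ^ d * ∑ k : Fin d → ZMod M, (eigenvalue k)⁻¹ := by
  simp [green]

theorem sum_green : ∑ x : Fin d → ZMod M, green x = 0 := by
  simp only [green]
  rw [← Finset.mul_sum, Finset.sum_comm]
  simp only [← Finset.mul_sum, ← Complex.re_sum]
  rw [Finset.sum_eq_zero, mul_zero]
  intro k _
  simp only [character_comm k, sum_character]
  split_ifs with h
  · simp [h]
  · simp

theorem green_neg (x : Fin d → ZMod M) : green (-x) = green x := by
  have h : ∀ k : Fin d → ZMod M, (character k (-x)).re = (character k x).re := by
    intro k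
    simp only [character, Pi.neg_apply, neg_mul, AddChar.map_neg_eq_conj, ← map_prod,
      Complex.conj_re]
  simp only [green, h]

/-- The inverse eigenvalues undo the Laplacian on every mode but k = 0; the missing mode is the
constant 1/N. -/
theorem laplacian_green (x : Fin d → ZMod M) :
    ∑ j, ((green x - green (x + Pi.single j 1)) + (green x - green (x - Pi.single j 1)))
      = (if x = 0 then 1 else 0) - 1 / (M : ℝ) ^ d := by
  have hM : (M : ℝ) ≠ 0 := by exact_mod_cast NeZero.ne M
  have h1 : ∑ j, ((green x - green (x + Pi.single j 1)) + (green x - green (x - Pi.single j 1)))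
      = 1 / (M : ℝ) ^ d * ∑ k : Fin d → ZMod M,
          (eigenvalue k)⁻¹ * (eigenvalue k * (character k x).re) := by
    have h2 : ∀ k : Fin d → ZMod M, eigenvalue k * (character k x).re
        = ∑ j, (((character k x).re - (character k (x + Pi.single j 1)).re)
          + ((character k x).re - (character k (x - Pi.single j 1)).re)) := by
      intro k
      have := congrArg Complex.re (laplacian_character k x)
      rw [Complex.re_ofReal_mul, Complex.re_sum] at this
      simpa using this.symm
    simp only [h2]
    simp only [Finset.mul_sum]
    rw [Finset.sum_comm]
    refine Finset.sum_congr rfl fun j _ => ?_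
    simp only [green, Finset.mul_sum, ← Finset.sum_sub_distrib, ← Finset.sum_add_distrib]
    refine Finset.sum_congr rfl fun k _ => ?_
    ring
  have h3 : ∀ k : Fin d → ZMod M, (eigenvalue k)⁻¹ * (eigenvalue k * (character k x).re)
      = (character k x).re - if k = 0 then 1 else 0 := by
    intro k
    split_ifs with h
    · subst h
      simp [character]
    · rw [inv_mul_cancel_left₀ (eigenvalue_pos h).ne', sub_zero]
  rw [h1]
  simp only [h3, Finset.sum_sub_distrib, ← Complex.re_sum, sum_character, Finset.sum_ite_eq',
    Finset.mem_univ, if_true]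
  split_ifs with h
  · rw [← Complex.ofReal_natCast, ← Complex.ofReal_pow, Complex.ofReal_re]
    field_simp
  · simp

theorem effectiveResistance_equalToroidalGrid (hM : 3 ≤ M) (u v : Fin d → ZMod M) :
    effectiveResistance (equalToroidalGrid d M) u v = 2 * green (0 : Fin d → ZMod M) - 2 * green (u - v) := by
  -- The constants -1/N cancel in the difference of two Green functions.
  have hW : IsPotential (equalToroidalGrid d M) u v (fun w => green (w - u) - green (w - v)) := by
    intro w
    rw [sum_adj_equalToroidalGrid hM w
      (fun x => green (w - u) - green (w - v) - (green (x - u) - green (x - v)))]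
    have hu := laplacian_green (w - u)
    have hv := laplacian_green (w - v)
    simp only [sub_eq_zero] at hu hv
    have huv := congrArg₂ (· - ·) hu hv
    simp only [sub_sub_sub_cancel_right, ← Finset.sum_sub_distrib] at huv
    convert huv using 1
    · refine Finset.sum_congr rfl fun j _ => ?_
      simp only [add_sub_right_comm, sub_right_comm w (Pi.single j 1)]
      ring
    · congr
  rw [effectiveResistance_eq (connected_equalToroidalGrid (by omega)) hW]
  simp only [sub_self]
  rw [← neg_sub u v, green_neg]
  ring

theorem averageResistance_equalToroidalGrid (hM : 3 ≤ M) :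
    averageResistance (equalToroidalGrid d M)
      = 1 / (M : ℝ) ^ d * ∑ k : Fin d → ZMod M, (eigenvalue k)⁻¹ := by
  have hM0 : (M : ℝ) ≠ 0 := by exact_mod_cast NeZero.ne M
  have hcard : (Fintype.card (Fin d → ZMod M) : ℝ) = (M : ℝ) ^ d := by
    simp [ZMod.card]
  have hsum : ∀ u : Fin d → ZMod M, ∑ v, green (u - v) = 0 := fun u => by
    rw [← sum_green (d := d) (M := M)]
    exact Fintype.sum_equiv (Equiv.subLeft u) _ _ fun _ => rfl
  rw [← green_zero]
  unfold averageResistance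
  simp only [effectiveResistance_equalToroidalGrid hM, Finset.sum_sub_distrib, ← Finset.mul_sum,
    hsum, Finset.sum_const, Finset.card_univ, nsmul_eq_mul, hcard]
  field_simp
  simp

end Torus

theorem theorem3 (d M : ℕ) [NeZero M] (hd : 3 ≤ d) (hM : 4 ≤ M) :
    averageResistance (equalToroidalGrid d M) ≤
        8 / ((d : ℝ) + 1) * (1 + 1 / (M : ℝ)) ^ (d + 1)
          + (d : ℝ) / (4 * (M : ℝ) ^ (d - 2))
            * (1 / 3 + ((d : ℝ) - 1) * Real.log (M : ℝ) / Real.pi) ∧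
      1 / (4 * (d : ℝ)) ≤ averageResistance (equalToroidalGrid d M) := by
  have hd3 : (3 : ℝ) ≤ d := by exact_mod_cast hd
  have hM4 : (4 : ℝ) ≤ M := by exact_mod_cast hM
  rw [Torus.averageResistance_equalToroidalGrid (by omega)]
  constructor
  · refine (Torus.average_inv_eigenvalue_le hd).trans ?_
    have hlog : 0 ≤ (d : ℝ) / (4 * (M : ℝ) ^ (d - 2))
        * (1 / 3 + ((d : ℝ) - 1) * Real.log (M : ℝ) / Real.pi) := by
      have h1 : 0 ≤ Real.log (M : ℝ) := Real.log_nonneg (by linarith)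
      have h2 : 0 ≤ (d : ℝ) - 1 := by linarith
      have := Real.pi_pos
      positivity
    -- Bernoulli turns the power into a surplus 8/M, which absorbs 1/(8M); the logarithmic term is
    -- only used as nonnegative.
    have hbern : 1 + ((d : ℝ) + 1) * (1 / (M : ℝ)) ≤ (1 + 1 / (M : ℝ)) ^ (d + 1) := by
      have h := one_add_mul_le_pow (a := 1 / (M : ℝ))
        (le_trans (by norm_num) (by positivity : (0 : ℝ) ≤ 1 / (M : ℝ))) (d + 1)
      push_cast at h
      exact h
    have h1 : 81 / (16 * (d : ℝ)) ≤ 8 / ((d : ℝ) + 1) := by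
      rw [div_le_div_iff₀ (by positivity) (by positivity)]
      linarith
    have h2 : 1 / (8 * (M : ℝ)) ≤ 8 * (1 / (M : ℝ)) := by
      rw [mul_one_div, div_le_div_iff₀ (by positivity) (by positivity)]
      linarith
    have h3 : 8 / ((d : ℝ) + 1) + 8 * (1 / (M : ℝ))
        = 8 / ((d : ℝ) + 1) * (1 + ((d : ℝ) + 1) * (1 / (M : ℝ))) := by
      field_simp
    have h4 : 8 / ((d : ℝ) + 1) * (1 + ((d : ℝ) + 1) * (1 / (M : ℝ)))
        ≤ 8 / ((d : ℝ) + 1) * (1 + 1 / (M : ℝ)) ^ (d + 1) := by gcongr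
    linarith
  · have h := Torus.average_inv_eigenvalue_ge (ι := Fin d) (M := M)
      (by rw [Fintype.card_fin]; omega) (by omega)
    simpa only [Fintype.card_fin] using h
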